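/- For elements $a,b$ of a group write $[a,b]=a^{-1}b^{-1}ab$ and $b^a=a^{-1}ba$. Let $\alpha$ be an integer with $\alpha\notin\{0,1,2\}$, and let $$G(\alpha)=\langle x,y\mid x^{[x,y]}=x^{\alpha},\ y^{[y,x]}=y^{\alpha}\rangle$$ be the Macdonald group. Let $p$ be a prime factor of $\alpha-1$, let $m=v_p(\alpha-1)$ be the exponent of $p$ in $\alpha-1$, and let $J$ be the Sylow $p$-subgroup of $G(\alpha)$. Then $J$ has the presentation $$\langle x,y\mid x^{[x,y]}=x^{\alpha},\ y^{[y,x]}=y^{\alpha},\ x^{N}=1,\ y^{N}=1\rangle,$$ where - (Case 1) $N=p^{3m}$ if $p>3$, or if $p=3$ and either $m>1$ or $(\alpha-1)/3\equiv 1\pmod 3$; - (Case 2) $N=2^{3m-1}$ if $p=2$; - (Case 3) $N=81$ if $p=3$, $m=1$ and $(\alpha-1)/3\equiv -1\pmod 3$. -/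

import Mathlib

/-- The conjugate `b ^ a = a⁻¹ b a`. -/
def conjBy {T : Type*} [Group T] (b a : T) : T := a⁻¹ * b * a

/-- The commutator `[a, b] = a⁻¹ b⁻¹ a b` (Mathlib's `⁅a, b⁆` is `a b a⁻¹ b⁻¹`). -/
def commBy {T : Type*} [Group T] (a b : T) : T := a⁻¹ * b⁻¹ * a * b

/-- The first free generator `x` of the free group on two letters. -/
def genX : FreeGroup (Fin 2) := FreeGroup.of 0

/-- The second free generator `y` of the free group on two letters. -/
def genY : FreeGroup (Fin 2) := FreeGroup.of 1

/-- The relators of `x ^ [x, y] = x ^ α` and `y ^ [y, x] = y ^ α`;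
a relation `r = s` is encoded by the relator `r s⁻¹`. -/
def macdonaldRels (α : ℤ) : Set (FreeGroup (Fin 2)) :=
  {conjBy genX (commBy genX genY) * (genX ^ α)⁻¹,
   conjBy genY (commBy genY genX) * (genY ^ α)⁻¹}

/-- The Macdonald group
`G(α) = ⟨x, y | x ^ [x, y] = x ^ α, y ^ [y, x] = y ^ α⟩`. -/
abbrev MacdonaldGroup (α : ℤ) : Type := PresentedGroup (macdonaldRels α)

/-- The group
`⟨x, y | x ^ [x, y] = x ^ α, y ^ [y, x] = y ^ α, x ^ N = 1, y ^ N = 1⟩`. -/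
abbrev TruncatedMacdonaldGroup (α : ℤ) (N : ℕ) : Type :=
  PresentedGroup (macdonaldRels α ∪ {genX ^ N, genY ^ N})

/-- Case 1: `p > 3`, or `p = 3` and either `v₃(α - 1) > 1` or `(α - 1) / 3 ≡ 1 mod 3`.
It is used only when `p` divides `α - 1`, so the division is exact. -/
def IsCase1 (α : ℤ) (p : ℕ) : Prop :=
  3 < p ∨ (p = 3 ∧ (1 < padicValInt p (α - 1) ∨ (α - 1) / 3 ≡ 1 [ZMOD 3]))

/-- Case 2: `p = 2`. -/
def IsCase2 (p : ℕ) : Prop := p = 2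

/-- Case 3: `p = 3`, `v₃(α - 1) = 1` and `(α - 1) / 3 ≡ -1 mod 3`.
It is used only when `p` divides `α - 1`, so the division is exact. -/
def IsCase3 (α : ℤ) (p : ℕ) : Prop :=
  p = 3 ∧ padicValInt p (α - 1) = 1 ∧ (α - 1) / 3 ≡ -1 [ZMOD 3]

/-- `(A, B)` satisfies the defining relations of the Macdonald group `G(α)`. -/
structure IsMacdonaldPair {Q : Type*} [Group Q] (α : ℤ) (A B : Q) : Prop where
  left : conjBy A (commBy A B) = A ^ α
  right : conjBy B (commBy B A) = B ^ α

/-! The group is finite and nilpotent, so it projects onto its Sylow subgroup `J`. If the `p`-parts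
of the orders of both generators divide `p ^ e`, the projection factors through the truncated group
`T`. Hence `J → T` is injective, and it is surjective because the generators of `T` are images of
`p`-elements. Only an upper bound on the `p`-part of the orders is needed, never their exact value.

The bound comes from one identity. For `N = α ^ k`, the power `B ^ N` is a conjugate of `B` by a
power of `C = [A, B]`. Computing the conjugate of `A` by `B ^ N` in two ways shows that a certain
power `A ^ f` is central, and since `C` raises it to the power `α`, `A ^ ((α - 1) * f) = 1`
(`zpow_eq_one`). This gives torsion, shows that only primes dividing `α - 1` occur in the orders
(`prime_dvd_sub_one`), and bounds their exponents by `p`-adic expansion in `u = α - 1`. The choice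
`k = 1` suffices in Cases 1 and 2; Case 3 also needs `k = 2`.

Finiteness and nilpotency follow by stripping one prime at a time from a common exponent of the
generators, at the cost of two central quotients (`finite_and_isNilpotent`). -/

theorem commBy_inv {Q : Type*} [Group Q] (A B : Q) : (commBy A B)⁻¹ = commBy B A := by
  simp [commBy, mul_assoc]

theorem conj_zpow_eq {Q : Type*} [Group Q] (g h : Q) (n : ℤ) :
    (g⁻¹ * h * g) ^ n = g⁻¹ * h ^ n * g := by
  simpa using (conj_zpow (i := n) (a := g⁻¹) (b := h))

/-! ### Commutation identities and torsion of the generators. -/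

namespace IsMacdonaldPair

variable {Q : Type*} [Group Q] {α : ℤ} {A B : Q}

theorem symm (h : IsMacdonaldPair α A B) : IsMacdonaldPair α B A := ⟨h.right, h.left⟩

theorem map {R : Type*} [Group R] (h : IsMacdonaldPair α A B) (f : Q →* R) :
    IsMacdonaldPair α (f A) (f B) := by
  constructor
  · simpa [conjBy, commBy] using congrArg f h.left
  · simpa [conjBy, commBy] using congrArg f h.right

theorem conj_comm_zpow (h : IsMacdonaldPair α A B) (x : ℤ) :
    (commBy A B)⁻¹ * A ^ x * commBy A B = A ^ (α * x) := by
  rw [← conj_zpow_eq, zpow_mul]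
  exact congrArg (· ^ x) h.left

theorem conj_comm_pow_zpow (h : IsMacdonaldPair α A B) (j : ℕ) (x : ℤ) :
    (commBy A B ^ j)⁻¹ * A ^ x * commBy A B ^ j = A ^ (α ^ j * x) := by
  induction j generalizing x with
  | zero => simp
  | succ j ih =>
    rw [pow_succ' α, mul_assoc α, ← h.conj_comm_zpow, ← ih]
    group

theorem mul_comm_pow (h : IsMacdonaldPair α A B) (n : ℕ) :
    (A * commBy A B) ^ n = commBy A B ^ n * A ^ (α * ∑ i ∈ Finset.range n, α ^ i) := by
  induction n with
  | zero => simp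
  | succ n ih =>
    have key : A ^ (α * ∑ i ∈ Finset.range n, α ^ i) * (A * commBy A B) =
        commBy A B * A ^ (α * (α * ∑ i ∈ Finset.range n, α ^ i + 1)) := by
      have := h.conj_comm_zpow (α * ∑ i ∈ Finset.range n, α ^ i + 1)
      rw [← this, zpow_add_one]
      group
    rw [pow_succ, ih, mul_assoc, key, ← mul_assoc, ← pow_succ, Finset.sum_range_succ',
      Finset.mul_sum]
    congr 3
    simp [pow_succ']

theorem conj_right_pow (h : IsMacdonaldPair α A B) (n : ℕ) :
    B⁻¹ * A ^ n * B = commBy A B ^ n * A ^ (α * ∑ i ∈ Finset.range n, α ^ i) := by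
  rw [← h.mul_comm_pow]
  -- The conjugate of `A ^ n` by `B` is therefore a power of `A * C`, already expanded by moving
  -- every `C` to the left.
  have : A * commBy A B = B⁻¹ * A * B := by simp [commBy, mul_assoc]
  rw [this]
  have := conj_zpow_eq B A n
  simpa using this.symm

/-- Compare two expansions of `B ^ (-N) * A * B ^ N`: one writes `B ^ N = C ^ k * B * C ^ (-k)`, the
other uses `A * (A⁻¹ * B ^ N * A)⁻¹ * B ^ N`. The exponent `f` is what remains after the powers of
`C` are collected. -/
theorem zpow_eq_conj (h : IsMacdonaldPair α A B) {k N : ℕ} (hN : (N : ℤ) = α ^ k) (f : ℤ)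
    (hf : f = α * ∑ i ∈ Finset.range N, α ^ i - N * α ^ N) :
    B ^ (-f) = A ^ (α ^ (N + k) * f) := by
  set s := ∑ i ∈ Finset.range N, α ^ i with hs
  set C := commBy A B with hC
  have hC' : commBy B A = C⁻¹ := (commBy_inv A B).symm
  -- first evaluation of the conjugate of `A` by `B ^ N`
  have hCB : C ^ k * B = B ^ N * C ^ k := by
    have := h.symm.conj_comm_pow_zpow k 1
    rw [hC', ← hN] at this
    simp only [inv_pow, inv_inv, zpow_one, mul_one, zpow_natCast] at this
    rw [← this]; group
  have e1 : (B ^ N)⁻¹ * A * B ^ N = C ^ k * (C ^ N * A ^ (α * s)) * (C ^ k)⁻¹ := by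
    have h1 := h.conj_comm_pow_zpow k 1
    rw [← hN, zpow_one, mul_one, zpow_natCast, ← hC] at h1
    have h2 := h.conj_right_pow N
    rw [← hC, ← hs, ← h1] at h2
    rw [← h2]
    have h3 : B ^ N = C ^ k * B * (C ^ k)⁻¹ := by rw [hCB]; group
    rw [h3]; group
  -- second evaluation
  have e2 : (B ^ N)⁻¹ * A * B ^ N = A * B ^ (-f) * C ^ N := by
    have h1 := h.symm.conj_right_pow N
    rw [hC', ← hs] at h1
    have h2 := h.symm.conj_comm_pow_zpow N N
    rw [hC'] at h2
    simp only [inv_pow, inv_inv, zpow_natCast] at h2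
    have h3 : (B ^ N)⁻¹ * A = A * (A⁻¹ * B ^ N * A)⁻¹ := by group
    have h4 : C ^ N * B ^ N = B ^ (α ^ N * N) * C ^ N := by rw [← h2]; group
    have h5 : (-f) = -(α * s) + α ^ N * N := by rw [hf]; ring
    rw [h3, h1, h5, zpow_add, inv_pow]
    simp only [mul_inv_rev, inv_inv, mul_assoc, h4, zpow_neg]
  have e3 := e1.symm.trans e2
  -- `X` is the `N`-th root `C ^ k * A * C ^ (-k)` of `A`
  have hX : ∀ x : ℤ, C ^ k * A ^ (N * x) * (C ^ k)⁻¹ = A ^ x := by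
    intro x
    have := h.conj_comm_pow_zpow k x
    rw [hN, ← this, ← hC]; group
  have e4 : C ^ k * A ^ f * (C ^ k)⁻¹ = (C ^ N)⁻¹ * B ^ (-f) * C ^ N := by
    have h1 := h.conj_comm_pow_zpow N (-1)
    rw [← hX (α ^ N * -1), ← hC] at h1
    have h2 : f = N * (α ^ N * -1) + α * s := by rw [hf]; ring
    have h3 : A⁻¹ * (C ^ k * (C ^ N * A ^ (α * s)) * (C ^ k)⁻¹) = B ^ (-f) * C ^ N := by
      rw [e3]; group
    rw [mul_assoc (_)⁻¹, ← h3]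
    nth_rewrite 1 [h2]
    rw [zpow_add]
    calc _ = (C ^ k * A ^ (N * (α ^ N * -1)) * (C ^ k)⁻¹) * (C ^ k * A ^ (α * s) * (C ^ k)⁻¹) := by
          group
      _ = _ := by rw [← h1]; simp only [zpow_neg_one]; group
  have e5 : A ^ f = (C ^ (N + k))⁻¹ * B ^ (-f) * C ^ (N + k) := by
    have : A ^ f = (C ^ k)⁻¹ * (C ^ k * A ^ f * (C ^ k)⁻¹) * C ^ k := by group
    rw [this, e4, pow_add]; group
  have h6 := h.symm.conj_comm_pow_zpow (N + k) (-f)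
  rw [hC'] at h6
  simp only [inv_pow, inv_inv] at h6
  rw [mul_comm (α ^ _) f, zpow_mul, e5, conj_zpow_eq, ← zpow_mul, mul_comm (-f), ← h6]
  group

/-- The exponent is `(α - 1) * f`. By the preceding lemma with the generators exchanged, `A ^ f` is
a power of `B`, so it commutes with `A`, `B` and their commutator, which also raises it to the power
`α`. -/
theorem zpow_eq_one (h : IsMacdonaldPair α A B) {k N : ℕ} (hN : (N : ℤ) = α ^ k) :
    A ^ (α * (α ^ N - 1) - (α - 1) * (N * α ^ N)) = 1 := by
  set f := α * ∑ i ∈ Finset.range N, α ^ i - N * α ^ N with hf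
  have h1 := h.symm.zpow_eq_conj hN f hf
  have hcB : Commute (A ^ f) B := by
    have : Commute (A ^ (-f)) B := by
      rw [h1]; exact (Commute.refl B).zpow_left _
    simpa using this.inv_left
  have hcA : Commute (A ^ f) A := (Commute.refl A).zpow_left _
  have hcC : Commute (A ^ f) (commBy A B) :=
    ((hcA.inv_right.mul_right hcB.inv_right).mul_right hcA).mul_right hcB
  have h2 := h.conj_comm_zpow f
  rw [mul_assoc, hcC.eq, inv_mul_cancel_left] at h2
  have h3 : α * (α ^ N - 1) - (α - 1) * (N * α ^ N) = α * f - f := by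
    rw [hf, ← geom_sum_mul α N]; ring
  rw [h3, zpow_sub, ← h2, mul_inv_cancel]

/-- For `α = -1` and even `k`, `N = 1` and the general exponent vanishes. Here `B ^ 2 = A ^ (-2)`
makes `A ^ 2` central, while the commutator inverts it. -/
theorem pow_four_eq_one (h : IsMacdonaldPair (-1) A B) : A ^ 4 = 1 := by
  have h1 := h.conj_comm_zpow 1
  have h2 := h.symm.conj_comm_zpow 1
  rw [← commBy_inv A B, inv_inv] at h2
  set C := commBy A B with hC
  have hAC : B⁻¹ * A * B = A * C := by simp [hC, commBy, mul_assoc]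
  have hBC : A⁻¹ * B * A = B * C⁻¹ := by simp [hC, commBy, mul_assoc]
  simp only [zpow_one, mul_one, zpow_neg_one] at h1 h2
  have h3 : B * A * B⁻¹ = A⁻¹ * C⁻¹ := by
    have e : C * B = B⁻¹ * C := by rw [← h2]; group
    have e1 : B⁻¹ * (C⁻¹ * A * C) * B = C⁻¹ * A⁻¹ := by
      rw [h1, ← mul_inv_rev A C, ← hAC]; group
    have e2 : B⁻¹ * (C⁻¹ * A * C) * B = (C * B)⁻¹ * A * (C * B) := by group
    rw [e2, e] at e1
    calc B * A * B⁻¹ = C * ((B⁻¹ * C)⁻¹ * A * (B⁻¹ * C)) * C⁻¹ := by group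
      _ = _ := by rw [e1]; group
  have h4 : B * C⁻¹ = C⁻¹ * B⁻¹ := by rw [← h2]; group
  have h5 : A⁻¹ * (B * A * B⁻¹) = C⁻¹ * B⁻¹ * B⁻¹ := by
    rw [← h4, ← hBC]; group
  have h6 : B ^ 2 = (A ^ 2)⁻¹ := by
    rw [h3] at h5
    have e : C⁻¹ * B⁻¹ * C = B := by
      rw [← h4]; group
    calc B ^ 2 = (C⁻¹ * B⁻¹ * C) ^ 2 := by rw [e]
      _ = C⁻¹ * B⁻¹ * B⁻¹ * C := by rw [pow_two]; group
      _ = _ := by rw [← h5]; group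
  have hcB : Commute (A ^ 2) B := by
    have : Commute ((A ^ 2)⁻¹) B := by rw [← h6]; exact (Commute.refl B).pow_left 2
    simpa using this.inv_left
  have hcA : Commute (A ^ 2) A := (Commute.refl A).pow_left 2
  have hcC : Commute (A ^ 2) C :=
    ((hcA.inv_right.mul_right hcB.inv_right).mul_right hcA).mul_right hcB
  have h7 : A ^ 2 = (A ^ 2)⁻¹ := by
    calc A ^ 2 = C⁻¹ * A ^ 2 * C := by rw [mul_assoc, hcC.eq, inv_mul_cancel_left]
      _ = (C⁻¹ * A * C) ^ 2 := by rw [pow_two, pow_two]; group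
      _ = _ := by rw [h1, inv_pow]
  calc A ^ 4 = A ^ 2 * A ^ 2 := by rw [← pow_add]
    _ = 1 := by nth_rewrite 1 [h7]; exact inv_mul_cancel _

/-- The generators of a Macdonald pair are torsion. -/
theorem isOfFinOrder (h : IsMacdonaldPair α A B) (h0 : α ≠ 0) (h1 : α ≠ 1) : IsOfFinOrder A := by
  by_cases hα : α = -1
  · subst hα
    exact isOfFinOrder_iff_pow_eq_one.2 ⟨4, by norm_num, h.pow_four_eq_one⟩
  -- Taking `k = 2` keeps `N` a natural number for negative `α`. If the exponent were zero, `α ^ 2`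
  -- would divide `α`, making `α` a unit.
  have hN : ((α.natAbs ^ 2 : ℕ) : ℤ) = α ^ 2 := by simp
  refine isOfFinOrder_iff_zpow_eq_one.2 ⟨_, fun hz => ?_, h.zpow_eq_one hN⟩
  obtain ⟨j, hj⟩ : ∃ j, α.natAbs ^ 2 = j + 1 :=
    Nat.exists_eq_succ_of_ne_zero (by positivity)
  rw [hN, hj] at hz
  have hd : α * α ∣ α := ⟨α ^ j - (α - 1) * α ^ (j + 1), by linear_combination -hz⟩
  have : α ∣ 1 := by
    have := (mul_dvd_mul_iff_left h0).1 (hd.trans (mul_one α).symm.dvd)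
    exact this
  rcases Int.isUnit_iff.1 (isUnit_of_dvd_one this) with h | h <;> contradiction

end IsMacdonaldPair

/-! ### Divisibility of `α ^ k - 1` and a pigeonhole principle. -/

theorem exists_geom_sum_eq (y : ℤ) (n : ℕ) :
    ∃ w z : ℤ, (1 + y) ^ n = 1 + n * y + y ^ 2 * w ∧
      2 * ∑ i ∈ Finset.range n, (1 + y) ^ i = 2 * n + n * (n - 1) * y + y ^ 2 * (2 * z) := by
  induction n with
  | zero => exact ⟨0, 0, by simp, by simp⟩
  | succ n ih =>
    obtain ⟨w, z, h1, h2⟩ := ih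
    refine ⟨n + w + y * w, z + w, ?_, ?_⟩
    · rw [pow_succ, h1]; push_cast; ring
    · rw [Finset.sum_range_succ, mul_add, h2, h1]; push_cast; ring

theorem geom_sum_prime_eq {q : ℕ} (hq : q.Prime) {y : ℤ} (hy : (q : ℤ) ∣ y) :
    ∃ c : ℤ, ∑ i ∈ Finset.range q, (1 + y) ^ i = q * c ∧ y ∣ 2 * (c - 1) := by
  obtain ⟨c, hc⟩ : (q : ℤ) ∣ ∑ i ∈ Finset.range q, (1 + y) ^ i := by
    have : ∑ i ∈ Finset.range q, (1 + y) ^ i ≡ ∑ i ∈ Finset.range q, 1 [ZMOD q] := by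
      refine Int.ModEq.sum fun i _ => ?_
      have h1 : 1 + y ≡ 1 [ZMOD q] := by
        simpa using (Int.ModEq.refl 1).add (Int.modEq_zero_iff_dvd.2 hy)
      simpa using h1.pow i
    rw [← Int.modEq_zero_iff_dvd]
    exact this.trans (by simp)
  refine ⟨c, hc, ?_⟩
  obtain ⟨-, z, -, h2⟩ := exists_geom_sum_eq y q
  obtain ⟨y', hy'⟩ := hy
  refine ⟨(q - 1) + y' * (2 * z), ?_⟩
  have hq0 : (q : ℤ) ≠ 0 := by exact_mod_cast hq.ne_zero
  apply mul_left_cancel₀ hq0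
  rw [hc] at h2
  linear_combination h2 + 2 * y * z * hy'

/-- If every prime factor of `k` divides `α - 1`, then `k * (α - 1)` divides `α ^ k - 1`, with a
cofactor congruent to `1` up to a factor `2`. -/
theorem pow_sub_one_eq (α : ℤ) (k : ℕ) (hk0 : k ≠ 0)
    (hk : ∀ q : ℕ, q.Prime → q ∣ k → (q : ℤ) ∣ α - 1) :
    ∃ c : ℤ, α ^ k - 1 = (α - 1) * (k * c) ∧ α - 1 ∣ 2 * (c - 1) := by
  induction k using induction_on_primes with
  | zero => exact absurd rfl hk0
  | one => exact ⟨1, by simp, by simp⟩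
  | prime_mul q a hq ih =>
    obtain ⟨c, h1, h2⟩ := ih (by rintro rfl; simp at hk0)
      fun q' hq' hd => hk q' hq' (hd.mul_left _)
    have hqd : (q : ℤ) ∣ α ^ a - 1 := by
      rw [h1]; exact (hk q hq (dvd_mul_right _ _)).mul_right _
    obtain ⟨c', h3, h4⟩ := geom_sum_prime_eq hq hqd
    refine ⟨c * c', ?_, ?_⟩
    · have h5 := geom_sum_mul (α ^ a) q
      rw [← pow_mul, mul_comm a q] at h5
      rw [← h5]
      have : (1 + (α ^ a - 1)) = α ^ a := by ring
      rw [this] at h3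
      rw [h3, h1]; push_cast; ring
    · have h6 : α - 1 ∣ 2 * (c' - 1) := by
        refine Dvd.dvd.trans ?_ h4
        rw [h1]; exact dvd_mul_right _ _
      have : 2 * (c * c' - 1) = 2 * (c - 1) * c' + 2 * (c' - 1) := by ring
      rw [this]
      exact dvd_add (h2.mul_right _) h6

/-- The strict bound `d < e` is what matters. Among `x ^ 0, …, x ^ (e - 1)` either two powers
coincide, or all residues occur, `0` among them, and then `d = 1` works. -/
theorem exists_pow_eq_pow_add {e : ℕ} (he : 1 < e) (x : ZMod e) :
    ∃ k d : ℕ, 0 < d ∧ d < e ∧ x ^ (k + d) = x ^ k := by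
  have : NeZero e := ⟨by omega⟩
  by_cases hinj : Function.Injective fun i : Fin e => x ^ (i : ℕ)
  · have hb := (Fintype.bijective_iff_injective_and_card _).2 ⟨hinj, by simp [ZMod.card]⟩
    obtain ⟨i, hi⟩ := hb.2 0
    exact ⟨i, 1, one_pos, he, by rw [pow_succ]; simp_all⟩
  · simp only [Function.Injective, not_forall] at hinj
    obtain ⟨i, j, hij, hne⟩ := hinj
    rcases lt_or_gt_of_ne hne with h | h
    · exact ⟨i, j - i, by omega, by omega, by
        rw [Nat.add_sub_cancel' (by exact_mod_cast h.le)]; exact hij.symm⟩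
    · exact ⟨j, i - j, by omega, by omega, by
        rw [Nat.add_sub_cancel' (by exact_mod_cast h.le)]; exact hij⟩

/-! ### Central quotients and finiteness. -/

theorem mem_center_of_commute {Q : Type*} [Group Q] {A B g : Q}
    (hcl : Subgroup.closure {A, B} = ⊤) (hA : Commute g A) (hB : Commute g B) :
    g ∈ Subgroup.center Q := by
  have : Subgroup.closure {A, B} ≤ Subgroup.centralizer {g} := by
    rw [Subgroup.closure_le]
    rintro x (rfl | rfl)
    · exact Subgroup.mem_centralizer_singleton_iff.2 (by simpa using hA.symm.eq)
    · exact Subgroup.mem_centralizer_singleton_iff.2 (by simpa using hB.symm.eq)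
  rw [hcl] at this
  rw [Subgroup.mem_center_iff]
  intro x
  exact Subgroup.mem_centralizer_singleton_iff.1 (this (Subgroup.mem_top x))

theorem closure_pair_map_eq_top {Q R : Type*} [Group Q] [Group R] {A B : Q}
    (hcl : Subgroup.closure {A, B} = ⊤) (f : Q →* R) (hf : Function.Surjective f) :
    Subgroup.closure {f A, f B} = ⊤ := by
  have := congrArg (Subgroup.map f) hcl
  rwa [MonoidHom.map_closure, Set.image_pair, Subgroup.map_top_of_surjective f hf] at this

/-- A group generated by two torsion elements is finite if its central quotient is. -/
theorem finite_of_finite_quotient_center {Q : Type*} [Group Q] {A B : Q}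
    (hcl : Subgroup.closure {A, B} = ⊤) (hA : IsOfFinOrder A) (hB : IsOfFinOrder B)
    [Finite (Q ⧸ Subgroup.center Q)] : Finite Q := by
  have : Finite (commutatorSet Q) := by
    -- A commutator depends only on the classes of its entries modulo the centre, so there are
    -- finitely many; by Schur's theorem the derived subgroup is then finite.
    let F : (Q ⧸ Subgroup.center Q) × (Q ⧸ Subgroup.center Q) → Q :=
      fun x => x.1.out * x.2.out * x.1.out⁻¹ * x.2.out⁻¹
    refine (Set.finite_range F).subset ?_ |>.to_subtype
    rintro _ ⟨x, y, rfl⟩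
    refine ⟨(x, y), ?_⟩
    obtain ⟨z, hz⟩ := QuotientGroup.mk_out_eq_mul (Subgroup.center Q) x
    obtain ⟨z', hz'⟩ := QuotientGroup.mk_out_eq_mul (Subgroup.center Q) y
    simp only [F, hz, hz', commutatorElement_def]
    have h1 := Subgroup.mem_center_iff.1 z.2
    have h2 := Subgroup.mem_center_iff.1 z'.2
    have h1' : ∀ g, g * (z : Q)⁻¹ = (z : Q)⁻¹ * g :=
      Subgroup.mem_center_iff.1 (inv_mem z.2)
    have h2' : ∀ g, g * (z' : Q)⁻¹ = (z' : Q)⁻¹ * g :=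
      Subgroup.mem_center_iff.1 (inv_mem z'.2)
    calc x * z * (y * z') * (x * z)⁻¹ * (y * z')⁻¹
        = x * (z * (y * (z' * ((z : Q)⁻¹ * x⁻¹)))) * ((z' : Q)⁻¹ * y⁻¹) := by group
      _ = x * (z * (y * ((z : Q)⁻¹ * x⁻¹ * z'))) * ((z' : Q)⁻¹ * y⁻¹) := by rw [h2 (_ * _)]
      _ = x * (z * (y * (z : Q)⁻¹)) * x⁻¹ * y⁻¹ := by group
      _ = x * y * x⁻¹ * y⁻¹ := by rw [h1']; group
  have : Finite (Abelianization Q) := by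
    have hcl' := closure_pair_map_eq_top hcl Abelianization.of
      (QuotientGroup.mk'_surjective _)
    have : Group.FG (Abelianization Q) := Group.fg_iff.2 ⟨_, hcl', Set.toFinite _⟩
    refine CommGroup.finite_of_fg_isMulTorsion _ fun g => ?_
    have hle : Subgroup.closure {Abelianization.of A, Abelianization.of B} ≤
        CommGroup.torsion (Abelianization Q) := by
      rw [Subgroup.closure_le]
      rintro _ (rfl | rfl)
      · exact MonoidHom.isOfFinOrder _ hA
      · exact MonoidHom.isOfFinOrder _ hB
    rw [hcl'] at hle
    exact hle (Subgroup.mem_top g)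
  have : Finite (commutator Q) := inferInstance
  have : Finite (Q ⧸ commutator Q) := ‹Finite (Abelianization Q)›
  exact Finite.of_subgroup_quotient (commutator Q)

/-! ### Primes dividing the orders of the generators; nilpotency. -/

namespace IsMacdonaldPair

universe u

variable {Q : Type u} [Group Q] {α : ℤ} {A B : Q}

theorem congr_exponent (h : IsMacdonaldPair α A B) {D : ℤ} (hA : A ^ D = 1) (hB : B ^ D = 1)
    {β : ℤ} (hβ : D ∣ β - α) : IsMacdonaldPair β A B := by
  obtain ⟨c, hc⟩ := hβ
  have : β = α + D * c := by rw [← hc]; ring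
  subst this
  constructor
  · rw [h.left, zpow_add, zpow_mul, hA, one_zpow, mul_one]
  · rw [h.right, zpow_add, zpow_mul, hB, one_zpow, mul_one]

/-- `A ^ a` is conjugate to `A`, so it has the same order. -/
theorem coprime_orderOf {a : ℕ} (h : IsMacdonaldPair (a : ℤ) A B) (hA : IsOfFinOrder A) :
    (orderOf A).Coprime a := by
  have h1 : orderOf (A ^ a) = orderOf A := by
    have := h.left
    rw [zpow_natCast] at this
    rw [← this]
    have := orderOf_injective (MulAut.conj (commBy A B)⁻¹).toMonoidHom
      (MulAut.conj (commBy A B)⁻¹).injective A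
    simpa [conjBy] using this
  rw [hA.orderOf_pow] at h1
  have h2 := hA.orderOf_pos
  have := Nat.gcd_dvd_left (orderOf A) a
  exact (Nat.div_eq_self.1 h1).resolve_left h2.ne'

theorem prime_dvd_sub_one {a : ℕ} (h : IsMacdonaldPair (a : ℤ) A B) (hA : IsOfFinOrder A)
    {q : ℕ} (hq : q.Prime) (hqA : q ∣ orderOf A) : (q : ℤ) ∣ a - 1 := by
  by_contra hcon
  have : Fact q.Prime := ⟨hq⟩
  have hx0 : (a : ZMod q) ≠ 0 := by
    rw [Ne, ZMod.natCast_eq_zero_iff]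
    intro hd
    exact hq.one_lt.ne' (Nat.eq_one_of_dvd_coprimes (h.coprime_orderOf hA) hqA hd)
  have hx1 : (a : ZMod q) - 1 ≠ 0 := by
    have := mt (ZMod.intCast_zmod_eq_zero_iff_dvd ((a : ℤ) - 1) q).1 hcon
    simpa using this
  have key : ∀ k : ℕ, (a : ZMod q) * ((a : ZMod q) ^ (a ^ k) - 1) =
      (a - 1) * ((a : ZMod q) ^ k * (a : ZMod q) ^ (a ^ k)) := by
    intro k
    have h1 := h.zpow_eq_one (k := k) (N := a ^ k) (by push_cast; rfl)
    rw [← orderOf_dvd_iff_zpow_eq_one] at h1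
    have h2 := (ZMod.intCast_zmod_eq_zero_iff_dvd _ q).2
      ((Int.natCast_dvd_natCast.2 hqA).trans h1)
    push_cast at h2
    linear_combination h2
  generalize (a : ZMod q) = x at *
  have he : 0 < orderOf x := orderOf_pos_iff.2 (isOfFinOrder_iff_pow_eq_one.2
    ⟨q - 1, by have := hq.two_le; omega, ZMod.pow_card_sub_one_eq_one hx0⟩)
  have he1 : orderOf x ≠ 1 := by
    rw [Ne, orderOf_eq_one_iff]
    rintro h1
    exact hx1 (by rw [h1, sub_self])
  -- With `a ^ (k + d) ≡ a ^ k` modulo the order of `x`, the left sides of `key` agree at `k` and `k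
  -- + d`. Comparing right sides gives `x ^ d = 1` with `0 < d < orderOf x`.
  obtain ⟨k, d, hd0, hd, hkd⟩ := exists_pow_eq_pow_add (by omega : 1 < orderOf x) (a : ZMod _)
  have hpow : x ^ (a ^ (k + d)) = x ^ (a ^ k) := by
    have hmod : a ^ (k + d) ≡ a ^ k [MOD orderOf x] := by
      rw [← ZMod.natCast_eq_natCast_iff]
      push_cast; exact hkd
    rw [← pow_mod_orderOf, hmod, pow_mod_orderOf]
  have h1 := key (k + d)
  rw [hpow, key k] at h1
  have h2 := mul_right_cancel₀ (pow_ne_zero _ hx0) (mul_left_cancel₀ hx1 h1)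
  have h3 : x ^ d = 1 := by
    rw [pow_add] at h2
    exact mul_left_cancel₀ (pow_ne_zero k hx0) (by rw [← h2, mul_one])
  exact absurd (orderOf_dvd_of_pow_eq_one h3) (Nat.not_dvd_of_pos_of_lt hd0 hd)

theorem commute_pow_of_comm_pow_eq_one (h : IsMacdonaldPair α A B) (hα : α ≠ 1) {k r : ℕ}
    (hr : r.Prime) (hrα : (r : ℤ) ∣ α - 1) {c : ℤ} (hc : α ^ k - 1 = (α - 1) * (k * c))
    (hc' : α - 1 ∣ 2 * (c - 1)) (hA : A ^ (r * k) = 1) (hC : commBy A B ^ k = 1) :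
    Commute (A ^ k) B := by
  have h1 := h.conj_right_pow k
  have hs : ∑ i ∈ Finset.range k, α ^ i = k * c := by
    have := geom_sum_mul α k
    rw [hc, mul_comm] at this
    exact mul_left_cancel₀ (sub_ne_zero.2 hα) this
  rw [hC, one_mul, hs] at h1
  have hrA : ∀ j : ℤ, (r : ℤ) ∣ j → A ^ ((k : ℤ) * j) = 1 := by
    rintro _ ⟨j, rfl⟩
    have : (k : ℤ) * (r * j) = ((r * k : ℕ) : ℤ) * j := by push_cast; ring
    rw [this, zpow_mul, zpow_natCast, hA, one_zpow]
  -- For odd `r` the second alternative holds; for `r = 2` the factor `2` in `hc'` leaves the parity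
  -- of `c` open. If `r ∣ c`, then `A ^ k = 1`; otherwise `α * c ≡ 1` modulo `r`, and `B` fixes `A ^
  -- k`.
  have hcase : (r : ℤ) ∣ c ∨ (r : ℤ) ∣ c - 1 := by
    rcases (Nat.prime_iff_prime_int.1 hr).dvd_or_dvd (hrα.trans hc') with h2 | h2
    · have : r = 2 := (Nat.prime_dvd_prime_iff_eq hr Nat.prime_two).1 (by exact_mod_cast h2)
      subst this
      push_cast
      omega
    · exact Or.inr h2
  rcases hcase with h2 | h2
  · have h3 : A ^ (α * (k * c)) = 1 := by
      have := hrA (α * c) (h2.mul_left _)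
      rw [← this]; ring_nf
    rw [h3] at h1
    have : A ^ k = 1 := by
      calc A ^ k = B * (B⁻¹ * A ^ k * B) * B⁻¹ := by group
        _ = 1 := by rw [h1]; group
    rw [this]; exact Commute.one_left B
  · have h3 : A ^ (α * (k * c)) = A ^ k := by
      have h4 : (r : ℤ) ∣ α * c - 1 := by
        have : α * c - 1 = (α - 1) * c + (c - 1) := by ring
        rw [this]; exact dvd_add (hrα.mul_right _) h2
      have h5 : α * (k * c) = k * (α * c - 1) + k := by ring
      rw [h5, zpow_add, hrA _ h4, one_mul, zpow_natCast]
    rw [h3] at h1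
    calc A ^ k * B = B * (B⁻¹ * A ^ k * B) := by group
      _ = B * A ^ k := by rw [h1]

/-- Let `w = r * k` with `r` prime. Since `α ^ k ≡ 1` modulo `r * k`, `C ^ k` is central; once it is
killed, `A ^ k` and `B ^ k` become central. Two central quotients thus replace `w` by `k`. The group
is quantified inside the induction because it changes at each step. -/
theorem finite_and_isNilpotent (hα : α ≠ 1) (w : ℕ) :
    ∀ {Q : Type u} [Group Q] {A B : Q}, IsMacdonaldPair α A B → Subgroup.closure {A, B} = ⊤ →
      w ≠ 0 → (∀ q : ℕ, q.Prime → q ∣ w → (q : ℤ) ∣ α - 1) → A ^ w = 1 → B ^ w = 1 →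
      Finite Q ∧ Group.IsNilpotent Q := by
  induction w using induction_on_primes with
  | zero => intro _ _ _ _ _ _ h; exact absurd rfl h
  | one =>
    intro Q _ A B h hcl _ _ hA hB
    rw [pow_one] at hA hB
    have : Subsingleton Q := by
      rw [← Subgroup.subsingleton_iff, ← subsingleton_iff_bot_eq_top, ← hcl, hA, hB, Set.pair_eq_singleton,
        Subgroup.closure_singleton_one]
    exact ⟨inferInstance, inferInstance⟩
  | prime_mul r k hr ih =>
    intro Q _ A B h hcl hw hwα hA hB
    have hk0 : k ≠ 0 := by rintro rfl; simp at hw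
    have hkα : ∀ q : ℕ, q.Prime → q ∣ k → (q : ℤ) ∣ α - 1 :=
      fun q hq hd => hwα q hq (hd.mul_left _)
    have hrα := hwα r hr (dvd_mul_right _ _)
    obtain ⟨c, hc, hc'⟩ := pow_sub_one_eq α k hk0 hkα
    have hcomm : ∀ {A B : Q}, IsMacdonaldPair α A B → A ^ (r * k) = 1 →
        Commute (commBy A B ^ k) A := by
      intro A B h hA
      have h1 := h.conj_comm_pow_zpow k 1
      have h2 : A ^ (α ^ k * 1) = A := by
        obtain ⟨v, hv⟩ := hrα
        have : α ^ k * 1 = ((r * k : ℕ) : ℤ) * (v * c) + 1 := by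
          push_cast
          linear_combination hc + k * c * hv
        rw [this, zpow_add, zpow_mul, zpow_natCast, hA]; simp
      rw [h2, zpow_one, mul_assoc, inv_mul_eq_iff_eq_mul] at h1
      exact h1.symm
    have hCz : commBy A B ^ k ∈ Subgroup.center Q := by
      refine mem_center_of_commute hcl (hcomm h hA) ?_
      have := hcomm h.symm hB
      rw [← commBy_inv, inv_pow] at this
      simpa using this.inv_left
    let π := QuotientGroup.mk' (Subgroup.center Q)
    have hπ : Function.Surjective π := QuotientGroup.mk'_surjective _
    have h1 := h.map π
    have hcl1 := closure_pair_map_eq_top hcl π hπ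
    have hC1 : commBy (π A) (π B) ^ k = 1 := by
      have : π (commBy A B ^ k) = 1 := (QuotientGroup.eq_one_iff _).2 hCz
      simpa [commBy] using this
    have hC1' : commBy (π B) (π A) ^ k = 1 := by
      rw [← commBy_inv, inv_pow, hC1, inv_one]
    have hA1 : π A ^ (r * k) = 1 := by rw [← map_pow, hA, map_one]
    have hB1 : π B ^ (r * k) = 1 := by rw [← map_pow, hB, map_one]
    have hAz : π A ^ k ∈ Subgroup.center _ :=
      mem_center_of_commute hcl1 ((Commute.refl _).pow_left k)
        (h1.commute_pow_of_comm_pow_eq_one hα hr hrα hc hc' hA1 hC1)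
    have hBz : π B ^ k ∈ Subgroup.center _ :=
      mem_center_of_commute hcl1
        (h1.symm.commute_pow_of_comm_pow_eq_one hα hr hrα hc hc' hB1 hC1')
        ((Commute.refl _).pow_left k)
    let ρ := QuotientGroup.mk' (Subgroup.center (Q ⧸ Subgroup.center Q))
    have hρ : Function.Surjective ρ := QuotientGroup.mk'_surjective _
    obtain ⟨hf, hn⟩ := ih (h1.map ρ) (closure_pair_map_eq_top hcl1 ρ hρ) hk0 hkα
      (by rw [← map_pow]; exact (QuotientGroup.eq_one_iff _).2 hAz)
      (by rw [← map_pow]; exact (QuotientGroup.eq_one_iff _).2 hBz)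
    have hpos : 0 < r * k := Nat.pos_of_ne_zero hw
    have hf1 : Finite (Q ⧸ Subgroup.center Q) := finite_of_finite_quotient_center hcl1
      (isOfFinOrder_iff_pow_eq_one.2 ⟨_, hpos, hA1⟩) (isOfFinOrder_iff_pow_eq_one.2 ⟨_, hpos, hB1⟩)
    exact ⟨finite_of_finite_quotient_center hcl (isOfFinOrder_iff_pow_eq_one.2 ⟨_, hpos, hA⟩)
      (isOfFinOrder_iff_pow_eq_one.2 ⟨_, hpos, hB⟩),
      Group.of_quotient_center_nilpotent (Group.of_quotient_center_nilpotent hn)⟩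

end IsMacdonaldPair

/-! ### The `p`-adic size of the order bound. -/

theorem exists_one_add_pow_eq (u : ℤ) (n : ℕ) :
    ∃ c₂ c₃ c₄ z : ℤ, 2 * c₂ = n * (n - 1) ∧ 6 * c₃ = n * (n - 1) * (n - 2) ∧
      24 * c₄ = n * (n - 1) * (n - 2) * (n - 3) ∧
      (1 + u) ^ n = 1 + n * u + c₂ * u ^ 2 + c₃ * u ^ 3 + c₄ * u ^ 4 + u ^ 5 * z := by
  induction n with
  | zero => exact ⟨0, 0, 0, 0, by simp, by simp, by simp, by simp⟩
  | succ n ih =>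
    obtain ⟨c₂, c₃, c₄, z, h₂, h₃, h₄, h⟩ := ih
    refine ⟨c₂ + n, c₃ + c₂, c₄ + c₃, c₄ + z + u * z, ?_, ?_, ?_, ?_⟩
    · push_cast; linear_combination h₂
    · push_cast; linear_combination h₃ + 3 * h₂
    · push_cast; linear_combination h₄ + 4 * h₃
    · rw [pow_succ, h]; push_cast; ring

/-- For a Macdonald pair with parameter `α = 1 + u` and `n + 1` a power of `α`, the orders of the
generators divide this integer. -/
def orderBound (u : ℤ) (n : ℕ) : ℤ := (1 + u) ^ n * (1 - n * u) - 1

/-- This is the choice `N = α`, that is `k = 1`. The factor `6` clears binomial denominators; the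
leading term `-3 * u ^ 3` gives the expected valuation `3 * m`, less one when `p = 2`. -/
theorem exists_six_mul_orderBound_eq {u : ℤ} {n : ℕ} (hn : (n : ℤ) = u) :
    ∃ z, 6 * orderBound u n = -(u ^ 3 * (3 + u + 2 * u ^ 3 - 6 * (u * z))) := by
  obtain ⟨c₂, c₃, c₄, z, h₂, h₃, h₄, h⟩ := exists_one_add_pow_eq u n
  refine ⟨(c₄ + u * z) * (1 - u ^ 2) - c₃ * u, ?_⟩
  rw [orderBound, h]
  rw [hn] at *
  linear_combination 3 * h₂ * u ^ 2 * (1 - u ^ 2) + h₃ * u ^ 3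

theorem exists_orderBound_eq (u : ℤ) (n : ℕ) :
    ∃ z, 24 * orderBound u n = -12 * u ^ 2 * (n * (n + 1)) +
      u ^ 3 * (n * (n - 1) * (-8 - 8 * n)) +
      u ^ 4 * (n * (n - 1) * (n - 2) * (-3 - 3 * n)) + 24 * u ^ 5 * z := by
  obtain ⟨c₂, c₃, c₄, z, h₂, h₃, h₄, h⟩ := exists_one_add_pow_eq u n
  refine ⟨z * (1 - n * u) - c₄ * n, ?_⟩
  rw [orderBound, h]
  linear_combination (12 * h₂ * u ^ 2 + 4 * h₃ * u ^ 3 + h₄ * u ^ 4) -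
    (12 * h₂ * u ^ 3 * n + 4 * h₃ * u ^ 4 * n)

theorem not_dvd_orderBound_of_three_lt {p m : ℕ} (hp : p.Prime) (hp3 : 3 < p) (hm : m ≠ 0)
    {u v : ℤ} (hu : u = p ^ m * v) (hv : ¬ (p : ℤ) ∣ v) {n : ℕ} (hn : (n : ℤ) = u) :
    ¬ (p : ℤ) ^ (3 * m + 1) ∣ orderBound u n := by
  intro hd
  obtain ⟨z, hz⟩ := exists_six_mul_orderBound_eq hn
  have hpi := Nat.prime_iff_prime_int.1 hp
  have h1 : (p : ℤ) ^ (3 * m) * p ∣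
      (p : ℤ) ^ (3 * m) * (v ^ 3 * (3 + u + 2 * u ^ 3 - 6 * (u * z))) := by
    have h2 : (p : ℤ) ^ (3 * m) * (v ^ 3 * (3 + u + 2 * u ^ 3 - 6 * (u * z))) =
        -(6 * orderBound u n) := by
      rw [hz, hu]; ring
    rw [h2, ← pow_succ]
    exact (hd.mul_left _).neg_right
  have h2 := (mul_dvd_mul_iff_left (pow_ne_zero _ hpi.ne_zero)).1 h1
  have h3 := (hpi.dvd_or_dvd h2).resolve_left fun h => hv (hpi.dvd_of_dvd_pow h)
  have hpu : (p : ℤ) ∣ u := by rw [hu]; exact (dvd_pow_self _ hm).mul_right _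
  have h4 : (p : ℤ) ∣ 3 := by
    have : (3 : ℤ) = (3 + u + 2 * u ^ 3 - 6 * (u * z)) - u * (1 + 2 * u ^ 2 - 6 * z) := by ring
    rw [this]; exact dvd_sub h3 (hpu.mul_right _)
  have := Int.le_of_dvd (by norm_num) h4
  omega

theorem not_dvd_orderBound_three {m : ℕ} (hm : m ≠ 0) {u v : ℤ} (hu : u = 3 ^ m * v)
    (hv : ¬ (3 : ℤ) ∣ v) (hcase : 1 < m ∨ v ≡ 1 [ZMOD 3]) {n : ℕ} (hn : (n : ℤ) = u) :
    ¬ (3 : ℤ) ^ (3 * m + 1) ∣ orderBound u n := by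
  intro hd
  obtain ⟨z, hz⟩ := exists_six_mul_orderBound_eq hn
  have h1 : (3 : ℤ) ^ (3 * m) * 9 ∣
      (3 : ℤ) ^ (3 * m) * (v ^ 3 * (3 + u + 2 * u ^ 3 - 6 * (u * z))) := by
    have h2 : (3 : ℤ) ^ (3 * m) * (v ^ 3 * (3 + u + 2 * u ^ 3 - 6 * (u * z))) =
        -(6 * orderBound u n) := by
      rw [hz, hu]; ring
    rw [h2]
    obtain ⟨c, hc⟩ := hd
    exact ⟨-2 * c, by rw [hc]; ring⟩
  have h2 := (mul_dvd_mul_iff_left (pow_ne_zero _ (by norm_num))).1 h1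
  have hcop : IsCoprime (9 : ℤ) (v ^ 3) := by
    have : IsCoprime (3 : ℤ) v := (Int.prime_three.coprime_iff_not_dvd).2 hv
    have := this.pow (m := 2) (n := 3)
    norm_num at this
    exact this
  obtain ⟨y, hy⟩ := hcop.dvd_of_dvd_mul_left h2
  obtain ⟨m, rfl⟩ := Nat.exists_eq_succ_of_ne_zero hm
  have hu3 : u = 3 * (3 ^ m * v) := by rw [hu, pow_succ]; ring
  have ht : (3 : ℤ) ∣ 3 ^ m * v ∨ 3 ^ m * v ≡ 1 [ZMOD 3] := by
    rcases m with - | m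
    · exact Or.inr (by simpa using hcase)
    · exact Or.inl ((dvd_pow_self 3 m.succ_ne_zero).mul_right v)
  generalize 3 ^ m * v = t at *
  have h3 : u ^ 3 = 27 * t ^ 3 := by rw [hu3]; ring
  have h4 : u * z = 3 * (t * z) := by rw [hu3]; ring
  rw [h3, h4] at hy
  generalize t ^ 3 = t' at *
  generalize t * z = t'' at *
  -- Here `u = 3 * t`, and divisibility by `9` would force `t ≡ -1` modulo `3`; this is exactly what
  -- Case 3 allows.
  rcases ht with h | h
  · omega
  · have := h.eq
    omega

theorem not_dvd_orderBound_two {m : ℕ} (hm : m ≠ 0) {u v : ℤ} (hu : u = 2 ^ m * v)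
    (hv : ¬ (2 : ℤ) ∣ v) {n : ℕ} (hn : (n : ℤ) = u) :
    ¬ (2 : ℤ) ^ (3 * m) ∣ orderBound u n := by
  intro hd
  obtain ⟨z, hz⟩ := exists_six_mul_orderBound_eq hn
  have h1 : (2 : ℤ) ^ (3 * m) * 2 ∣
      (2 : ℤ) ^ (3 * m) * (v ^ 3 * (3 + u + 2 * u ^ 3 - 6 * (u * z))) := by
    have h2 : (2 : ℤ) ^ (3 * m) * (v ^ 3 * (3 + u + 2 * u ^ 3 - 6 * (u * z))) =
        -(6 * orderBound u n) := by
      rw [hz, hu]; ring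
    rw [h2]
    obtain ⟨c, hc⟩ := hd
    exact ⟨-3 * c, by rw [hc]; ring⟩
  have h2 := (mul_dvd_mul_iff_left (pow_ne_zero _ (by norm_num))).1 h1
  have h3 := (Int.prime_two.dvd_or_dvd h2).resolve_left fun h => hv (Int.prime_two.dvd_of_dvd_pow h)
  have h4 : (2 : ℤ) ∣ u := by rw [hu]; exact (dvd_pow_self _ hm).mul_right _
  omega

/-- Neither bound suffices alone. With `v = 3 * w + 2`, the first divisibility forces `w ≡ 2` modulo
`3` and the second, coming from `N = α ^ 2`, forces `w ≡ 0`. -/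
theorem not_dvd_orderBound_of_modEq_neg_one {u v : ℤ} (hu : u = 3 * v) (hv : v ≡ -1 [ZMOD 3])
    {n n' : ℕ} (hn : (n : ℤ) = u) (hn' : (n' : ℤ) = (1 + u) ^ 2 - 1) :
    ¬ ((3 : ℤ) ^ 5 ∣ orderBound u n ∧ (3 : ℤ) ^ 5 ∣ orderBound u n') := by
  rintro ⟨⟨c, hc⟩, ⟨c', hc'⟩⟩
  obtain ⟨z, hz⟩ := exists_orderBound_eq u n
  obtain ⟨z', hz'⟩ := exists_orderBound_eq u n'
  obtain ⟨w, hw⟩ : ∃ w, v = 3 * w + 2 := ⟨v / 3, by have := hv.eq; omega⟩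
  have hu' : u = 9 * w + 6 := by rw [hu, hw]; ring
  rw [hn, hc] at hz
  rw [hn', hc'] at hz'
  subst hu'
  -- Both `24 * 3 ^ 5` and `24 * u ^ 5` are divisible by `3 ^ 6`; cancelling the factor `27` from `u
  -- ^ 3` leaves a congruence modulo `27` in `w`.
  have e : (((3 * w + 2) ^ 3 * (-12 * (9 * w + 7) - 8 * (9 * w + 6) * (9 * w + 5) * (9 * w + 7) -
      3 * (9 * w + 6) ^ 2 * (9 * w + 5) * (9 * w + 4) * (9 * w + 7)) : ℤ) : ZMod 27) = 0 := by
    rw [ZMod.intCast_zmod_eq_zero_iff_dvd]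
    exact ⟨8 * c - 8 * (3 * w + 2) ^ 5 * z, mul_left_cancel₀ (by norm_num : (27 : ℤ) ≠ 0)
      (by push_cast; linear_combination -hz)⟩
  have e' : (((3 * w + 2) ^ 3 * (9 * w + 8) * (-12 * (9 * w + 7) ^ 2 -
      8 * (9 * w + 6) * ((9 * w + 7) ^ 2 - 2) * (9 * w + 7) ^ 2 -
      3 * (9 * w + 6) ^ 2 * ((9 * w + 7) ^ 2 - 2) * ((9 * w + 7) ^ 2 - 3) * (9 * w + 7) ^ 2) : ℤ) :
      ZMod 27) = 0 := by
    rw [ZMod.intCast_zmod_eq_zero_iff_dvd]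
    exact ⟨8 * c' - 8 * (3 * w + 2) ^ 5 * z', mul_left_cancel₀ (by norm_num : (27 : ℤ) ≠ 0)
      (by push_cast; linear_combination -hz')⟩
  push_cast at e e'
  generalize (w : ZMod 27) = x at e e'
  revert x
  decide

/-! ### Bounding the `p`-part of the orders of the generators. -/

namespace IsMacdonaldPair

variable {Q : Type*} [Group Q] {α : ℤ} {A B : Q}

theorem orderOf_dvd_orderBound {a : ℕ} (h : IsMacdonaldPair (a : ℤ) A B) (hA : IsOfFinOrder A)
    {k n : ℕ} (hn : n + 1 = a ^ k) : (orderOf A : ℤ) ∣ orderBound (a - 1) n := by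
  have h1 := h.zpow_eq_one (k := k) (N := n + 1) (by rw [hn]; push_cast; rfl)
  rw [← orderOf_dvd_iff_zpow_eq_one] at h1
  -- The extra factor `a` is harmless because it is coprime to the order of `A`.
  have h2 : (a : ℤ) * (a ^ (n + 1) - 1) - (a - 1) * ((n + 1 : ℕ) * a ^ (n + 1)) =
      a * orderBound (a - 1) n := by
    rw [orderBound]; push_cast; ring
  rw [h2] at h1
  exact (Nat.isCoprime_iff_coprime.2 (h.coprime_orderOf hA)).dvd_of_dvd_mul_left h1

/-- The parameter of a Macdonald pair can be replaced by a natural number congruent to it modulo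
a given integer and the order of a generator. -/
theorem exists_nat (h : IsMacdonaldPair α A B) (h0 : α ≠ 0) (h1 : α ≠ 1) {s : ℕ} (hs : 0 < s) :
    ∃ a : ℕ, 2 ≤ a ∧ IsMacdonaldPair (a : ℤ) A B ∧ (orderOf A : ℤ) ∣ a - α ∧ (s : ℤ) ∣ a - α := by
  have hA := (h.isOfFinOrder h0 h1).orderOf_pos
  have hB := (h.symm.isOfFinOrder h0 h1).orderOf_pos
  have hD : 0 < orderOf A * orderOf B * s := by positivity
  have hge : (2 : ℤ) ≤ α + (orderOf A * orderOf B * s : ℕ) * (|α| + 2) := by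
    have h2 : (1 : ℤ) ≤ (orderOf A * orderOf B * s : ℕ) := by exact_mod_cast hD
    nlinarith [neg_abs_le α, abs_nonneg α]
  obtain ⟨a, ha⟩ := Int.eq_ofNat_of_zero_le (le_trans (by norm_num) hge)
  have hsub : (a : ℤ) - α = orderOf A * orderOf B * s * (|α| + 2) := by
    rw [← ha]; push_cast; ring
  refine ⟨a, by omega, h.congr_exponent (D := orderOf A * orderOf B) ?_ ?_ ?_, ?_, ?_⟩
  · rw [zpow_mul]; simp [pow_orderOf_eq_one]
  · rw [mul_comm, zpow_mul]; simp [pow_orderOf_eq_one]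
  · rw [hsub, mul_assoc]; exact dvd_mul_right _ _
  · rw [hsub, mul_assoc, mul_assoc]; exact dvd_mul_right _ _
  · rw [hsub]; exact (dvd_mul_left _ _).mul_right _

theorem prime_dvd_sub_one_of_dvd_orderOf (h : IsMacdonaldPair α A B) (h0 : α ≠ 0) (h1 : α ≠ 1)
    {q : ℕ} (hq : q.Prime) (hqA : q ∣ orderOf A) : (q : ℤ) ∣ α - 1 := by
  obtain ⟨a, -, ha, hda, -⟩ := h.exists_nat h0 h1 one_pos
  have h2 := ha.prime_dvd_sub_one (h.isOfFinOrder h0 h1) hq hqA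
  have h3 : α - 1 = (a - 1) - (a - α) := by ring
  rw [h3]
  exact dvd_sub h2 ((Int.natCast_dvd_natCast.2 hqA).trans hda)

theorem not_pow_dvd_orderOf (h : IsMacdonaldPair α A B) (h0 : α ≠ 0) (h1 : α ≠ 1)
    {p m e : ℕ} (hp : p.Prime) (hm : m ≠ 0) {v : ℤ} (hα : α - 1 = p ^ m * v) (hv : ¬ (p : ℤ) ∣ v)
    (hcase : ((3 < p ∨ p = 3 ∧ (1 < m ∨ v ≡ 1 [ZMOD 3])) ∧ e = 3 * m) ∨
      (p = 2 ∧ e = 3 * m - 1) ∨ (p = 3 ∧ m = 1 ∧ v ≡ -1 [ZMOD 3] ∧ e = 4)) :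
    ¬ p ^ (e + 1) ∣ orderOf A := by
  intro hd
  have hA := h.isOfFinOrder h0 h1
  -- Congruence modulo `p ^ (m + 1)` preserves both the valuation `m` and the residue of `v` modulo
  -- `p`.
  obtain ⟨a, ha2, ha, -, ⟨x, hx⟩⟩ := h.exists_nat h0 h1 (s := p ^ (m + 1)) (pow_pos hp.pos _)
  have hu : (a : ℤ) - 1 = p ^ m * (v + p * x) := by
    push_cast at hx
    linear_combination hα + hx
  have hv' : ¬ (p : ℤ) ∣ v + p * x := by rwa [dvd_add_left (dvd_mul_right _ _)]
  have hmod : v + p * x ≡ v [ZMOD p] := by simp [Int.ModEq]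
  have hdvd : ∀ k n : ℕ, n + 1 = a ^ k → (p : ℤ) ^ (e + 1) ∣ orderBound (a - 1) n := by
    intro k n hn
    refine Dvd.dvd.trans ?_ (ha.orderOf_dvd_orderBound hA hn)
    exact_mod_cast hd
  have hd1 := hdvd 1 (a - 1) (by rw [pow_one]; omega)
  have hn1 : ((a - 1 : ℕ) : ℤ) = a - 1 := by push_cast [Nat.one_le_of_lt ha2]; ring
  rcases hcase with ⟨h3 | ⟨rfl, h3⟩, rfl⟩ | ⟨rfl, rfl⟩ | ⟨rfl, rfl, h3, rfl⟩
  · exact not_dvd_orderBound_of_three_lt hp h3 hm hu hv' hn1 hd1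
  · exact not_dvd_orderBound_three hm hu hv' (h3.imp id hmod.trans) hn1 hd1
  · refine not_dvd_orderBound_two hm hu hv' hn1 ?_
    rwa [Nat.sub_add_cancel (by omega)] at hd1
  · refine not_dvd_orderBound_of_modEq_neg_one (by simpa using hu) (hmod.trans h3) hn1
      (n' := a ^ 2 - 1) ?_ ⟨hd1, hdvd 2 _ ?_⟩
    · rw [Nat.cast_sub (Nat.one_le_pow _ _ (by omega))]; push_cast; ring
    · exact Nat.sub_add_cancel (Nat.one_le_pow _ _ (by omega))

end IsMacdonaldPair

/-! ### Sylow subgroups of a finite nilpotent group as universal quotients. -/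

/-- A finite nilpotent group maps to each of its Sylow subgroups, injectively on that subgroup. -/
theorem Sylow.exists_hom_injOn {G : Type*} [Group G] [Finite G] [Group.IsNilpotent G] {p : ℕ}
    [Fact p.Prime] (J : Sylow p G) :
    ∃ π : G →* J, ∀ g ∈ J, π g = 1 → g = 1 := by
  by_cases hpG : p ∣ Nat.card G
  · let e := Sylow.directProductOfNormal (G := G) fun {q} _ P =>
      inferInstance
    let i : (Nat.card G).primeFactors :=
      ⟨p, Nat.mem_primeFactors.2 ⟨Fact.out, hpG, Nat.card_pos.ne'⟩⟩
    let π : G →* J := ((Pi.evalMonoidHom _ J).comp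
      (Pi.evalMonoidHom (fun q : (Nat.card G).primeFactors => ∀ P : Sylow q G, P) i)).comp
        e.symm.toMonoidHom
    have hπ : Function.Surjective π :=
      ((Function.surjective_eval (β := fun P : Sylow p G => P) J).comp
        (Function.surjective_eval (β := fun q : (Nat.card G).primeFactors =>
          ∀ P : Sylow q G, P) i)).comp e.symm.surjective
    refine ⟨π, fun g hg h1 => ?_⟩
    -- The kernel has order prime to `p`, so it meets `J` trivially.
    have hcard : Nat.card π.ker = (J : Subgroup G).index := by
      have h2 := π.ker.card_mul_index
      rw [Subgroup.index_ker, MonoidHom.range_eq_top.2 hπ, Subgroup.card_top,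
        ← (J : Subgroup G).index_mul_card] at h2
      exact Nat.eq_of_mul_eq_mul_right Nat.card_pos h2
    have hcop := J.card_coprime_index
    have h3 : orderOf g ∣ Nat.card J := Subgroup.orderOf_dvd_natCard _ hg
    have h4 : orderOf g ∣ Nat.card π.ker := Subgroup.orderOf_dvd_natCard _ h1
    rw [hcard] at h4
    exact orderOf_eq_one_iff.1 (Nat.eq_one_of_dvd_coprimes hcop h3 h4)
  · refine ⟨1, fun g hg _ => ?_⟩
    have h3 : orderOf g ∣ Nat.card J := Subgroup.orderOf_dvd_natCard _ hg
    obtain ⟨n, hn⟩ := IsPGroup.iff_card.1 J.isPGroup'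
    have h4 : orderOf g ∣ Nat.card G := orderOf_dvd_natCard g
    rw [hn] at h3
    have hcop : (p ^ n).Coprime (Nat.card G) :=
      Nat.Coprime.pow_left _ (((Fact.out : p.Prime).coprime_iff_not_dvd).2 hpG)
    exact orderOf_eq_one_iff.1 (Nat.eq_one_of_dvd_coprimes hcop h3 h4)

/-- An element has the same image, under a map killing its `p ^ e`-th power, as one of its powers
of `p`-power order. -/
theorem map_mem_map_sylow {G T : Type*} [Group G] [Finite G] [Group T] {p : ℕ} [Fact p.Prime]
    (J : Sylow p G) [hJ : (J : Subgroup G).Normal] (φ : G →* T) {e : ℕ} {A : G}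
    (hA : φ A ^ p ^ e = 1) : φ A ∈ (J : Subgroup G).map φ := by
  obtain ⟨j, c, hc, hd⟩ := Nat.exists_eq_pow_mul_and_not_dvd (orderOf_pos A).ne' p
    (Fact.out : p.Prime).ne_one
  have hcop : (p ^ e).Coprime c :=
    Nat.Coprime.pow_left _ (((Fact.out : p.Prime).coprime_iff_not_dvd).2 hc)
  -- `r ≡ 0` modulo `c` gives `A ^ r` order a power of `p`, while `r ≡ 1` modulo `p ^ e` keeps its
  -- image equal to `φ A`.
  obtain ⟨r, hr1, hr2⟩ := Nat.chineseRemainder hcop 1 0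
  refine ⟨A ^ r, ?_, ?_⟩
  · have hr : (A ^ r) ^ p ^ j = 1 := by
      obtain ⟨s, rfl⟩ := (Nat.modEq_zero_iff_dvd).1 hr2
      rw [← pow_mul, mul_right_comm, mul_comm c, ← hd, pow_mul, pow_orderOf_eq_one, one_pow]
    have hP : IsPGroup p (Subgroup.zpowers (A ^ r)) := by
      obtain ⟨i, -, hi⟩ := (Nat.dvd_prime_pow Fact.out).1 (orderOf_dvd_of_pow_eq_one hr)
      exact IsPGroup.of_card (n := i) (by rw [Nat.card_zpowers, hi])
    obtain ⟨P, hPle⟩ := hP.exists_le_sylow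
    have := Sylow.unique_of_normal J hJ
    have hPJ : P = J := Subsingleton.elim _ _
    exact hPJ ▸ hPle (Subgroup.mem_zpowers _)
  · rw [map_pow]
    have h1 : r ≡ 1 [MOD orderOf (φ A)] := hr1.of_dvd (orderOf_dvd_of_pow_eq_one hA)
    rw [← pow_mod_orderOf, h1, pow_mod_orderOf, pow_one]

/-- If `T` is the universal quotient of a finite nilpotent group in which `A ^ p ^ e` and `B ^ p ^ e`
vanish, and `p ^ (e + 1)` divides neither the order of `A` nor that of `B`, then `T` is isomorphic
to the Sylow `p`-subgroups. -/
theorem Sylow.nonempty_mulEquiv_of_universal {G T : Type*} [Group G] [Finite G]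
    [Group.IsNilpotent G] [Group T] {p : ℕ} [Fact p.Prime] (J : Sylow p G) {A B : G}
    {φ : G →* T} {e : ℕ} (hT : Subgroup.closure {φ A, φ B} = ⊤)
    (hφA : φ A ^ p ^ e = 1) (hφB : φ B ^ p ^ e = 1)
    (hA : ¬ p ^ (e + 1) ∣ orderOf A) (hB : ¬ p ^ (e + 1) ∣ orderOf B)
    (huniv : ∀ ψ : G →* J, ψ A ^ p ^ e = 1 → ψ B ^ p ^ e = 1 → ∃ χ : T →* J, χ.comp φ = ψ) :
    Nonempty (J ≃* T) := by
  have hJ : (J : Subgroup G).Normal := inferInstance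
  obtain ⟨π, hπ⟩ := J.exists_hom_injOn
  have hpow : ∀ g : G, ¬ p ^ (e + 1) ∣ orderOf g → π g ^ p ^ e = 1 := by
    intro g hg
    obtain ⟨i, hi⟩ := IsPGroup.iff_orderOf.1 J.isPGroup' (π g)
    have h1 : p ^ i ∣ orderOf g := hi ▸ orderOf_map_dvd π g
    have h2 : i ≤ e := by
      by_contra hlt
      exact hg ((pow_dvd_pow p (by omega)).trans h1)
    exact orderOf_dvd_iff_pow_eq_one.1 (hi ▸ pow_dvd_pow p h2)
  obtain ⟨χ, hχ⟩ := huniv π (hpow A hA) (hpow B hB)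
  refine ⟨MulEquiv.ofBijective (φ.comp (J : Subgroup G).subtype) ⟨?_, ?_⟩⟩
  · rw [injective_iff_map_eq_one]
    intro g hg
    have h1 : π g = 1 := by
      rw [← hχ, MonoidHom.comp_apply]
      exact (congrArg χ hg).trans (map_one χ)
    exact Subtype.ext (hπ g g.2 h1)
  · have hle : Subgroup.closure {φ A, φ B} ≤ (J : Subgroup G).map φ := by
      rw [Subgroup.closure_le]
      rintro _ (rfl | rfl)
      · exact map_mem_map_sylow J φ hφA
      · exact map_mem_map_sylow J φ hφB
    rw [hT] at hle
    intro t
    obtain ⟨g, hg, rfl⟩ := hle (Subgroup.mem_top t)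
    exact ⟨⟨g, hg⟩, rfl⟩

/-! ### Presentations and the final assembly. -/

theorem lift_macdonaldRels_eq_one {Q : Type*} [Group Q] {α : ℤ} {f : Fin 2 → Q}
    (h : IsMacdonaldPair α (f 0) (f 1)) : ∀ r ∈ macdonaldRels α, FreeGroup.lift f r = 1 := by
  rintro _ (rfl | rfl)
  · rw [map_mul, map_inv, mul_inv_eq_one]
    simpa [genX, genY, conjBy, commBy] using h.left
  · rw [map_mul, map_inv, mul_inv_eq_one]
    simpa [genX, genY, conjBy, commBy] using h.right

theorem lift_truncated_eq_one {Q : Type*} [Group Q] {α : ℤ} {f : Fin 2 → Q} {N : ℕ}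
    (h : IsMacdonaldPair α (f 0) (f 1)) (h0 : f 0 ^ N = 1) (h1 : f 1 ^ N = 1) :
    ∀ r ∈ macdonaldRels α ∪ {genX ^ N, genY ^ N}, FreeGroup.lift f r = 1 := by
  rintro r (hr | rfl | rfl)
  · exact lift_macdonaldRels_eq_one h r hr
  · simpa [genX] using h0
  · simpa [genY] using h1

theorem isMacdonaldPair_of {α : ℤ} {rels : Set (FreeGroup (Fin 2))}
    (hr : macdonaldRels α ⊆ rels) :
    IsMacdonaldPair α (PresentedGroup.of (rels := rels) 0) (PresentedGroup.of 1) := by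
  constructor
  · have := PresentedGroup.one_of_mem (hr (Or.inl rfl))
    rw [map_mul, map_inv, mul_inv_eq_one] at this
    simp only [conjBy, commBy, map_mul, map_inv, map_zpow] at this
    exact this
  · have := PresentedGroup.one_of_mem (hr (Or.inr rfl))
    rw [map_mul, map_inv, mul_inv_eq_one] at this
    simp only [conjBy, commBy, map_mul, map_inv, map_zpow] at this
    exact this

theorem closure_of_eq_top (rels : Set (FreeGroup (Fin 2))) :
    Subgroup.closure {PresentedGroup.of (rels := rels) 0, PresentedGroup.of 1} = ⊤ := by
  have := PresentedGroup.closure_range_of rels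
  have hr : Set.range (PresentedGroup.of (rels := rels)) =
      {PresentedGroup.of 0, PresentedGroup.of 1} := by
    ext x; simp [Fin.exists_fin_two, eq_comm]
  rwa [hr] at this

theorem nonempty_sylow_mulEquiv_truncated {α : ℤ} (h0 : α ≠ 0) (h1 : α ≠ 1) {p e : ℕ}
    [Fact p.Prime] (J : Sylow p (MacdonaldGroup α))
    (he : ∀ {A B : MacdonaldGroup α}, IsMacdonaldPair α A B → ¬ p ^ (e + 1) ∣ orderOf A) :
    Nonempty (J ≃* TruncatedMacdonaldGroup α (p ^ e)) := by
  let A : MacdonaldGroup α := PresentedGroup.of 0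
  let B : MacdonaldGroup α := PresentedGroup.of 1
  have h : IsMacdonaldPair α A B := isMacdonaldPair_of subset_rfl
  have hA := h.isOfFinOrder h0 h1
  have hB := h.symm.isOfFinOrder h0 h1
  obtain ⟨_, _⟩ := IsMacdonaldPair.finite_and_isNilpotent h1 (orderOf A * orderOf B) h
    (closure_of_eq_top _) (mul_pos hA.orderOf_pos hB.orderOf_pos).ne'
    (fun q hq hd => (hq.dvd_mul.1 hd).elim (h.prime_dvd_sub_one_of_dvd_orderOf h0 h1 hq)
      (h.symm.prime_dvd_sub_one_of_dvd_orderOf h0 h1 hq))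
    (by rw [pow_mul, pow_orderOf_eq_one, one_pow])
    (by rw [mul_comm, pow_mul, pow_orderOf_eq_one, one_pow])
  have hT : IsMacdonaldPair α (PresentedGroup.of (rels := macdonaldRels α ∪
      {genX ^ p ^ e, genY ^ p ^ e}) 0) (PresentedGroup.of 1) :=
    isMacdonaldPair_of Set.subset_union_left
  let φ : MacdonaldGroup α →* TruncatedMacdonaldGroup α (p ^ e) :=
    PresentedGroup.toGroup (lift_macdonaldRels_eq_one (f := PresentedGroup.of) hT)
  have hφ : ∀ i, φ (PresentedGroup.of i) = PresentedGroup.of i := fun i => PresentedGroup.toGroup.of _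
  refine J.nonempty_mulEquiv_of_universal (A := A) (B := B) (φ := φ) (e := e) ?_ ?_ ?_ (he h)
    (he h.symm) fun ψ hψA hψB => ?_
  · simp only [A, B, hφ]
    exact closure_of_eq_top _
  · simp only [A, hφ]
    have := PresentedGroup.one_of_mem (rels := macdonaldRels α ∪ {genX ^ p ^ e, genY ^ p ^ e})
      (Or.inr (Or.inl rfl))
    rwa [map_pow] at this
  · simp only [B, hφ]
    have := PresentedGroup.one_of_mem (rels := macdonaldRels α ∪ {genX ^ p ^ e, genY ^ p ^ e})
      (Or.inr (Or.inr rfl))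
    rwa [map_pow] at this
  · refine ⟨PresentedGroup.toGroup (lift_truncated_eq_one (f := fun i => ψ (PresentedGroup.of i))
      (h.map ψ) hψA hψB), PresentedGroup.ext fun i => ?_⟩
    rw [MonoidHom.comp_apply, hφ]
    exact PresentedGroup.toGroup.of _

theorem theorem5p3 (α : ℤ) (hα0 : α ≠ 0) (hα1 : α ≠ 1) (hα2 : α ≠ 2)
    (p : ℕ) (hp : p.Prime) (hdvd : (p : ℤ) ∣ α - 1)
    (m : ℕ) (hm : m = padicValInt p (α - 1))
    (J : Sylow p (MacdonaldGroup α)) :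
    (IsCase1 α p → Nonempty (J ≃* TruncatedMacdonaldGroup α (p ^ (3 * m)))) ∧
    (IsCase2 p → Nonempty (J ≃* TruncatedMacdonaldGroup α (2 ^ (3 * m - 1)))) ∧
    (IsCase3 α p → Nonempty (J ≃* TruncatedMacdonaldGroup α 81)) := by
  have : Fact p.Prime := ⟨hp⟩
  have hne : α - 1 ≠ 0 := sub_ne_zero.2 hα1
  obtain ⟨v, hv⟩ : (p : ℤ) ^ m ∣ α - 1 := hm ▸ padicValInt_dvd _
  have hpv : ¬ (p : ℤ) ∣ v := by
    rintro ⟨y, rfl⟩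
    have h1 : (p : ℤ) ^ (m + 1) ∣ α - 1 := ⟨y, by rw [hv]; ring⟩
    rcases (padicValInt_dvd_iff (m + 1) (α - 1)).1 h1 with h | h
    · exact hne h
    · omega
  have hm0 : m ≠ 0 := by
    rintro rfl
    rw [pow_zero, one_mul] at hv
    exact hpv (hv ▸ hdvd)
  have hdiv : p = 3 → m = 1 → (α - 1) / 3 = v := by
    rintro rfl rfl
    rw [hv]; simp
  refine ⟨fun h => ?_, fun h => ?_, fun h => ?_⟩
  · refine nonempty_sylow_mulEquiv_truncated hα0 hα1 J fun hAB =>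
      hAB.not_pow_dvd_orderOf hα0 hα1 hp hm0 hv hpv (Or.inl ⟨?_, rfl⟩)
    refine h.imp id fun ⟨h3, h⟩ => ⟨h3, ?_⟩
    rw [← hm] at h
    by_cases hm1 : 1 < m
    · exact Or.inl hm1
    · exact Or.inr (hdiv h3 (by omega) ▸ h.resolve_left hm1)
  · obtain rfl : p = 2 := h
    exact nonempty_sylow_mulEquiv_truncated hα0 hα1 J fun hAB =>
      hAB.not_pow_dvd_orderOf hα0 hα1 hp hm0 hv hpv (Or.inr (Or.inl ⟨rfl, rfl⟩))
  · obtain ⟨rfl, h1, h2⟩ := h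
    rw [← hm] at h1
    rw [hdiv rfl h1] at h2
    exact nonempty_sylow_mulEquiv_truncated (e := 4) hα0 hα1 J fun hAB =>
      hAB.not_pow_dvd_orderOf hα0 hα1 hp hm0 hv hpv (Or.inr (Or.inr ⟨rfl, h1, h2, rfl⟩))
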